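/- For $n\ge 0$ let $$q_n(u)=\sum_{k=0}^n \frac{\binom nk}{\binom{2n}{k}}\frac{2^k}{k!}\,u^k$$ be the Bessel polynomial of degree $n$ (normalized by $q_n(0)=1$). For $n,m\ge 0$ and real $a$ let $\beta_k^{(n,m)}(a)$ denote the coefficients in the unique expansion of the polynomial $q_n(au)\,q_m((1-a)u)$ in the basis $(q_k)_{k\ge0}$ of $\mathbb R[u]$. For $\nu>0$ let $$k_\nu(u)=\frac{2^{1-\nu}}{\Gamma(\nu)}u^\nu K_\nu(u)\quad(u>0),\qquad k_\nu(0)=\lim_{u\downarrow 0}k_\nu(u)=1,$$ where $K_\nu(u)=\int_0^\infty e^{-u\cosh t}\cosh(\nu t)\,dt$ is the modified Bessel function of the third kind. For $N\ge1$ and $\nu>0$ let $$f_{N,\nu}(x)=\frac{\Gamma(\nu+\frac N2)}{\Gamma(\nu)\,\Gamma(\frac12)^N}\,(1+|x|^2)^{-\nu-\frac N2},\qquad x\in\mathbb R^N,$$ where $|\cdot|$ is the Euclidean norm. Then, for every $N\ge 1$: (i) For every $\nu>0$, $f_{N,\nu}$ is a probability density on $\mathbb R^N$ (nonnegative, integrable,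 with integral $1$), and its characteristic function is $$\int_{\mathbb R^N}e^{i\langle x,y\rangle}f_{N,\nu}(x)\,dx=k_\nu(|y|),\qquad y\in\mathbb R^N.$$ (ii) For all integers $n,m\ge0$ and all $0<a<1$ one has $$q_n(au)\,q_m((1-a)u)=\sum_{k=\min(n,m)}^{n+m}\beta_k^{(n,m)}(a)\,q_k(u)\quad(u\in\mathbb R),\qquad \beta_k^{(n,m)}(a)\ge 0,\qquad \sum_{k=\min(n,m)}^{n+m}\beta_k^{(n,m)}(a)=1,$$ and, with the same coefficients, the convolution of the rescaled densities exists at every $x\in\mathbb R^N$ and satisfies $$\left(\frac1{a^N}f_{N,n+\frac12}\Big(\frac{\cdot}{a}\Big)*\frac1{(1-a)^N}f_{N,m+\frac12}\Big(\frac{\cdot}{1-a}\Big)\right)(x)=\sum_{k=\min(n,m)}^{n+m}\beta_k^{(n,m)}(a)\,f_{N,k+\frac12}(x).$$ -/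

import Mathlib

open Polynomial MeasureTheory
open scoped Convolution

noncomputable section

/-- The coefficient `α_k^{(n)} = (binom n k / binom (2n) k) * 2^k / k!`. -/
def besselCoeff (n k : ℕ) : ℝ :=
  (n.choose k : ℝ) / ((2 * n).choose k : ℝ) * (2 ^ k / (k.factorial : ℝ))

/-- The Bessel polynomial `q_n(u) = ∑_{k=0}^n α_k^{(n)} u^k`, normalized by `q_n(0) = 1`. -/
def besselPoly (n : ℕ) : ℝ[X] :=
  ∑ k ∈ Finset.range (n + 1), C (besselCoeff n k) * X ^ k

theorem besselPoly_coeff (n k : ℕ) :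
    (besselPoly n).coeff k = if k < n + 1 then besselCoeff n k else 0 := by
  simp [besselPoly, finsetSum_coeff, coeff_C_mul, coeff_X_pow]

theorem besselCoeff_self_ne_zero (n : ℕ) : besselCoeff n n ≠ 0 := by
  have h : (2 * n).choose n ≠ 0 := (Nat.choose_pos (by omega)).ne'
  have h2 : n.factorial ≠ 0 := n.factorial_ne_zero
  simp [besselCoeff, h, h2]

theorem besselPoly_degree (n : ℕ) : (besselPoly n).degree = n := by
  apply le_antisymm
  · rw [degree_le_iff_coeff_zero]
    intro m hm
    have hm' : n < m := by exact_mod_cast hm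
    rw [besselPoly_coeff, if_neg (by omega)]
  · apply le_degree_of_ne_zero
    rw [besselPoly_coeff, if_pos (by omega)]
    exact besselCoeff_self_ne_zero n

/-- The Bessel polynomials as a sequence of polynomials with `deg q_n = n`. -/
def besselSequence : Polynomial.Sequence ℝ where
  elems' := besselPoly
  degree_eq' := besselPoly_degree

/-- The Bessel polynomials form a basis of `ℝ[X]`. -/
def besselBasis : Module.Basis ℕ ℝ ℝ[X] :=
  besselSequence.basis fun i =>
    (leadingCoeff_ne_zero.mpr (besselSequence.ne_zero i)).isUnit

/-- The linearization coefficient `β_k^{(n,m)}(a)`: the coefficient of `q_k(u)` in the unique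
expansion of the polynomial `q_n(a u) q_m((1-a) u)` in the basis of Bessel polynomials. -/
def linCoeff (n m : ℕ) (a : ℝ) (k : ℕ) : ℝ :=
  besselBasis.repr
    ((besselPoly n).comp (C a * X) * (besselPoly m).comp (C (1 - a) * X)) k

/-- The modified Bessel function of the third kind (Macdonald function) for `u > 0`:
`K_ν(u) = ∫_0^∞ exp(-u cosh t) cosh(ν t) dt`. -/
def macdonaldK (ν u : ℝ) : ℝ :=
  ∫ t in Set.Ioi (0 : ℝ), Real.exp (-u * Real.cosh t) * Real.cosh (ν * t)

/-- `k_ν(u) = 2^{1-ν} / Γ(ν) * u^ν * K_ν(u)` for `u > 0`, extended to `u = 0` by its limit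
`k_ν(0) = 1`. -/
def studentK (ν u : ℝ) : ℝ :=
  if u = 0 then 1 else 2 ^ (1 - ν) / Real.Gamma ν * u ^ ν * macdonaldK ν u

/-- The rotation invariant `N`-variate Student-t density
`f_{N,ν}(x) = Γ(ν + N/2) / (Γ(ν) Γ(1/2)^N) * (1 + |x|^2)^{-ν - N/2}`. -/
def studentDensity (N : ℕ) (ν : ℝ) (x : EuclideanSpace ℝ (Fin N)) : ℝ :=
  Real.Gamma (ν + (N : ℝ) / 2) / (Real.Gamma ν * Real.Gamma (1 / 2) ^ N) *
    (1 + ‖x‖ ^ 2) ^ (-ν - (N : ℝ) / 2)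

end

/-!
The argument has an algebraic and an analytic half, linked by the identity
`k_{n+1/2}(u) = e^{-u} q_n(u)` (`studentK_nat_add_half`).

**Linearization.** Write `D` for differentiation. The Bessel polynomials satisfy
`(1 - D) q_{n+1} = u q_n / (2n+1)`. Since `1 - D` is injective on polynomials, `(1 - D) f = c + u g`
forces `f = c + L g`, where `L q_k = (2k+1) q_{k+1}` (`eq_C_add_besselLift`), and `L` maps
nonnegative combinations of `q_s, …, q_t` to nonnegative combinations of `q_{s+1}, …, q_{t+1}`. For
`f = q_{n+1}(au) q_{m+1}((1-a)u)` the recurrence gives `c = 0` and `g` a nonnegative combination of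
the products with indices `(n, m+1)` and `(n+1, m)`, so nonnegativity and the range of summation
follow by induction (`isBesselCombination_comp_mul_comp`). The initial case `q_n(au)` is treated in
the same way, once `q_n` is known to be `1` plus `u` times a nonnegative combination of lower Bessel
polynomials (`exists_besselPoly_eq_one_add_X_mul`); this comes from the lowering operator
`D - D²/2`, which maps `q_n` to a multiple of `q_{n-1}`, `u q_n` to a multiple of `u q_{n-1}`, and `u q_0` to `1`.
The coefficients sum to `1` because `q_k(0) = 1`.

**Characteristic function.** The density `(1 + |x|²)^{-ν-N/2}` is a Gamma mixture of Gaussians. By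
Fubini its characteristic function is a multiple of `∫ r^{ν-1} e^{-r - |y|²/(4r)} dr` over `r > 0`,
which the substitution `r = (|y|/2) e^t` turns into the integral defining `K_ν(|y|)`
(`integral_cexp_mul_studentDensity`).

**Convolution.** By the recurrence `K_{ν+1} = K_{ν-1} + (2ν/u) K_ν` and the value of `K_{1/2}`, the
functions `k_{n+1/2}(u)` obey the three-term recurrence of `e^{-u} q_n(u)`. The linearization
formula then says that the convolution and the mixture have the same characteristic function. Both
are continuous and integrable, so Fourier inversion shows that they agree at every point
(`convolution_scaledStudentDensity`).
-/

/-! ### Recurrences for Bessel polynomials -/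

theorem besselCoeff_zero_right (n : ℕ) : besselCoeff n 0 = 1 := by
  simp [besselCoeff]

/-- `besselCoeff n k` vanishes beyond the degree, so the recurrences below hold for all `k`. -/
theorem besselCoeff_eq_zero_of_lt {n k : ℕ} (h : n < k) : besselCoeff n k = 0 := by
  simp [besselCoeff, Nat.choose_eq_zero_of_lt h]

theorem coeff_besselPoly (n k : ℕ) : (besselPoly n).coeff k = besselCoeff n k := by
  rw [besselPoly_coeff]
  split_ifs with h
  · rfl
  · exact (besselCoeff_eq_zero_of_lt (by omega)).symm

theorem besselCoeff_succ_succ (n k : ℕ) :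
    (2 * n + 1) * (k + 1) * besselCoeff (n + 1) (k + 1) = (2 * n + 1 - k) * besselCoeff n k := by
  rcases lt_or_ge n k with h | h
  · rw [besselCoeff_eq_zero_of_lt h, besselCoeff_eq_zero_of_lt (by omega)]; ring
  · have h1 : ((n : ℝ) + 1) * n.choose k = (n + 1).choose (k + 1) * (k + 1) := by
      exact_mod_cast Nat.add_one_mul_choose_eq n k
    have h2 : ((2 * n : ℝ) + 2) * (2 * n + 1).choose k = (2 * (n + 1)).choose (k + 1) * (k + 1) := by
      exact_mod_cast Nat.add_one_mul_choose_eq (2 * n + 1) k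
    have h3 : ((2 * n).choose k : ℝ) * (2 * n + 1) = (2 * n + 1).choose k * (2 * n + 1 - k) := by
      have := Nat.choose_mul_succ_eq (2 * n) k
      have h4 : ((2 * n + 1 - k : ℕ) : ℝ) = 2 * n + 1 - k := by
        rw [Nat.cast_sub (by omega)]; push_cast; ring
      rw [← h4]; exact_mod_cast this
    have p1 : ((2 * n).choose k : ℝ) ≠ 0 := by
      exact_mod_cast (Nat.choose_pos (by omega)).ne'
    have p2 : ((2 * (n + 1)).choose (k + 1) : ℝ) ≠ 0 := by
      exact_mod_cast (Nat.choose_pos (by omega)).ne'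
    have p3 : (k.factorial : ℝ) ≠ 0 := by exact_mod_cast k.factorial_ne_zero
    have p4 : (k : ℝ) + 1 ≠ 0 := by positivity
    have p5 : (n : ℝ) + 1 ≠ 0 := by positivity
    have key : (2 * n + 1) * ((n + 1).choose (k + 1) : ℝ) * (2 * n).choose k * 2 =
        (2 * n + 1 - k) * n.choose k * (2 * (n + 1)).choose (k + 1) := by
      apply mul_right_cancel₀ p4
      linear_combination (-2 * (2 * n + 1) * ((2 * n).choose k : ℝ)) * h1
        + (2 * ((n : ℝ) + 1) * n.choose k) * h3 + (2 * n + 1 - k) * (n.choose k : ℝ) * h2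
    rw [besselCoeff, besselCoeff, Nat.factorial_succ, pow_succ]
    push_cast
    field_simp
    linear_combination key

theorem besselCoeff_succ_right (n k : ℕ) :
    (2 * n - k) * (k + 1) * besselCoeff n (k + 1) = 2 * (n - k) * besselCoeff n k := by
  rcases lt_trichotomy n k with h | rfl | h
  · rw [besselCoeff_eq_zero_of_lt h, besselCoeff_eq_zero_of_lt (by omega)]; ring
  · rw [besselCoeff_eq_zero_of_lt (Nat.lt_succ_self n)]; ring
  · have h1 : (n.choose (k + 1) : ℝ) * (k + 1) = n.choose k * (n - k) := by
      rw [← Nat.cast_sub h.le]; exact_mod_cast Nat.choose_succ_right_eq n k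
    have h2 : ((2 * n).choose (k + 1) : ℝ) * (k + 1) = (2 * n).choose k * (2 * n - k) := by
      have h4 : ((2 * n - k : ℕ) : ℝ) = 2 * n - k := by
        rw [Nat.cast_sub (by omega)]; push_cast; ring
      rw [← h4]; exact_mod_cast Nat.choose_succ_right_eq (2 * n) k
    have p1 : ((2 * n).choose k : ℝ) ≠ 0 := by
      exact_mod_cast (Nat.choose_pos (by omega)).ne'
    have p2 : ((2 * n).choose (k + 1) : ℝ) ≠ 0 := by
      exact_mod_cast (Nat.choose_pos (by omega)).ne'
    have p3 : (k.factorial : ℝ) ≠ 0 := by exact_mod_cast k.factorial_ne_zero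
    have p4 : (k : ℝ) + 1 ≠ 0 := by positivity
    have key : (2 * n - k) * (n.choose (k + 1) : ℝ) * (2 * n).choose k =
        (n - k) * n.choose k * (2 * n).choose (k + 1) := by
      apply mul_right_cancel₀ p4
      linear_combination ((2 * n - k) * ((2 * n).choose k : ℝ)) * h1 -
        (n - k) * (n.choose k : ℝ) * h2
    rw [besselCoeff, besselCoeff, Nat.factorial_succ, pow_succ]
    push_cast
    field_simp
    linear_combination key

theorem besselCoeff_succ_add_two (n k : ℕ) :
    (2 * n + 1) * (k + 1) * (k + 2) * besselCoeff (n + 1) (k + 2) =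
      2 * (n - k) * besselCoeff n k := by
  rcases lt_or_ge n k with h | h
  · rw [besselCoeff_eq_zero_of_lt h, besselCoeff_eq_zero_of_lt (by omega)]; ring
  · have h1 := besselCoeff_succ_succ n k
    have h2 := besselCoeff_succ_right (n + 1) (k + 1)
    push_cast at h2
    have h3 : (2 * n + 1 - k : ℝ) ≠ 0 := by
      have : (k : ℝ) ≤ n := by exact_mod_cast h
      have : (0 : ℝ) ≤ n := by positivity
      apply ne_of_gt; linarith
    apply mul_left_cancel₀ h3
    linear_combination (2 * n + 1) * ((k : ℝ) + 1) * h2 + 2 * ((n : ℝ) - k) * h1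

theorem besselCoeff_succ_one (n : ℕ) : besselCoeff (n + 1) 1 = 1 := by
  have h := besselCoeff_succ_succ n 0
  rw [besselCoeff_zero_right] at h
  have : (2 * n + 1 : ℝ) ≠ 0 := by positivity
  apply mul_left_cancel₀ this
  simpa using h

theorem besselPoly_zero : besselPoly 0 = 1 := by
  simp [besselPoly, besselCoeff]

theorem besselPoly_eval_zero (n : ℕ) : (besselPoly n).eval 0 = 1 := by
  rw [← coeff_zero_eq_eval_zero, coeff_besselPoly, besselCoeff_zero_right]

/-- The three-term recurrence `q_{n+2} = q_{n+1} + u² q_n / ((2n+1)(2n+3))`. -/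
theorem besselPoly_add_two (n : ℕ) :
    besselPoly (n + 2) =
      besselPoly (n + 1) + C (1 / ((2 * n + 1) * (2 * n + 3) : ℝ)) * (X ^ 2 * besselPoly n) := by
  ext k
  simp only [coeff_add, coeff_C_mul, coeff_X_pow_mul', coeff_besselPoly]
  rcases k with _ | _ | k
  · simp [besselCoeff_zero_right]
  · simp [besselCoeff_succ_one]
  · have h1 := besselCoeff_succ_succ n k
    have h2 := besselCoeff_succ_succ (n + 1) (k + 1)
    have h3 := besselCoeff_succ_add_two n k
    push_cast at h2
    simp only [add_assoc, one_add_one_eq_two] at h2 ⊢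
    simp only [le_add_iff_nonneg_left, zero_le, if_true, Nat.add_sub_cancel]
    have p1 : (k : ℝ) + 1 ≠ 0 := by positivity
    have p2 : (k : ℝ) + 2 ≠ 0 := by positivity
    field_simp
    apply mul_left_cancel₀ p1
    apply mul_left_cancel₀ p2
    linear_combination (2 * n + 1) * (k + 1) * h2 + (2 * n + 2 - k) * h1 - (2 * n + 3) * h3

/-- The differential recurrence `q_{n+1} - q_{n+1}' = u q_n / (2n+1)`. -/
theorem besselPoly_succ_sub_derivative (n : ℕ) :
    besselPoly (n + 1) - derivative (besselPoly (n + 1)) =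
      C (1 / (2 * n + 1 : ℝ)) * (X * besselPoly n) := by
  ext k
  simp only [coeff_sub, coeff_C_mul, coeff_derivative, coeff_besselPoly]
  rcases k with _ | k
  · simp [besselCoeff_zero_right, besselCoeff_succ_one, coeff_besselPoly]
  · have h1 := besselCoeff_succ_succ n k
    have h3 := besselCoeff_succ_add_two n k
    rw [coeff_X_mul, coeff_besselPoly]
    have p1 : (k : ℝ) + 1 ≠ 0 := by positivity
    push_cast
    field_simp
    apply mul_left_cancel₀ p1
    linear_combination h1 - h3

/-! ### The lowering operator -/

theorem besselBasis_apply (k : ℕ) : besselBasis k = besselPoly k :=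
  Polynomial.Sequence.basis_eq_self besselSequence _ k

/-- Differentiation lowers the degree, so `1 - cD` is injective on polynomials. -/
theorem eq_zero_of_eq_C_mul_derivative {p : ℝ[X]} {c : ℝ} (h : p = C c * derivative p) :
    p = 0 := by
  by_contra hp
  have h1 : (C c * derivative p).degree < p.degree := by
    rw [← smul_eq_C_mul]
    exact (degree_smul_le c (derivative p)).trans_lt (degree_derivative_lt hp)
  rw [← h] at h1
  exact lt_irrefl _ h1

/-- The operator `D - D²/2`, where `D` is differentiation. It maps `q_{n+1}` to a multiple of `q_n`
and `u q_{n+1}` to a multiple of `u q_n`. -/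
noncomputable def besselDelta : ℝ[X] →ₗ[ℝ] ℝ[X] :=
  derivative - (1 / 2 : ℝ) • derivative ∘ₗ derivative

theorem besselDelta_apply (f : ℝ[X]) :
    besselDelta f = derivative f - C (1 / 2) * derivative (derivative f) := by
  simp [besselDelta, smul_eq_C_mul]

/-- The kernel of `D - D²/2` on polynomials consists of the constants. -/
theorem eq_of_besselDelta_eq {f g : ℝ[X]} (h : besselDelta f = besselDelta g)
    (h0 : f.eval 0 = g.eval 0) : f = g := by
  have h1 : derivative (f - g) = 0 := by
    apply eq_zero_of_eq_C_mul_derivative (c := 1 / 2)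
    rw [besselDelta_apply, besselDelta_apply] at h
    simp only [derivative_sub]
    linear_combination h
  have h2 := eq_C_of_derivative_eq_zero h1
  rw [coeff_zero_eq_eval_zero, eval_sub, h0, sub_self, C_0] at h2
  exact sub_eq_zero.mp h2

theorem besselDelta_besselPoly_succ (n : ℕ) :
    besselDelta (besselPoly (n + 1)) = C ((n + 1) / (2 * n + 1) : ℝ) * besselPoly n := by
  rcases n with _ | n
  · have h1 : besselPoly 1 = 1 + X := by
      simp [besselPoly, Finset.sum_range_succ, besselCoeff]
      rw [← C_mul]; norm_num
    rw [zero_add, besselDelta_apply, h1, besselPoly_zero]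
    simp
  · have hA := besselPoly_succ_sub_derivative (n + 1)
    have hB := besselPoly_succ_sub_derivative n
    have hR := besselPoly_add_two n
    have hd := congrArg derivative hA
    rw [besselDelta_apply]
    have e1 : (2 * (n + 1 : ℕ) + 1 : ℝ) = 2 * n + 3 := by push_cast; ring
    have e2 : ((n + 1 : ℕ) + 1 : ℝ) / (2 * n + 3) = 1 / 2 + 1 / 2 * (1 / (2 * n + 3)) := by
      push_cast; field_simp; ring
    have e3 : (1 / ((2 * n + 1) * (2 * n + 3)) : ℝ) = 1 / (2 * n + 1) * (1 / (2 * n + 3)) := by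
      field_simp
    rw [e1] at hA hd ⊢
    rw [e2]
    rw [e3] at hR
    have e4 : (2 : ℝ[X]) * C (1 / 2) = 1 := by
      rw [← C_ofNat, ← C_mul]; norm_num
    simp only [C_mul, C_add, derivative_sub, derivative_mul, derivative_C, derivative_X] at hA hd hR ⊢
    generalize C (1 / (2 * n + 1) : ℝ) = c0 at *
    generalize C (1 / (2 * n + 3) : ℝ) = c1 at *
    generalize C (1 / 2 : ℝ) = h2 at *
    linear_combination h2 * hd - h2 * hA - (h2 * c1 * X) * hB + h2 * hR -
      derivative (besselPoly (n + 2)) * e4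

theorem besselDelta_X_mul_besselPoly_zero : besselDelta (X * besselPoly 0) = 1 := by
  simp [besselDelta_apply, besselPoly_zero]

theorem besselDelta_X_mul_besselPoly_succ (n : ℕ) :
    besselDelta (X * besselPoly (n + 1)) =
      C ((n + 2) / (2 * n + 1) : ℝ) * (X * besselPoly n) := by
  have hB := besselPoly_succ_sub_derivative n
  have hQ := besselDelta_besselPoly_succ n
  rw [besselDelta_apply] at hQ ⊢
  have e2 : ((n + 2) / (2 * n + 1) : ℝ) = (n + 1) / (2 * n + 1) + 1 / (2 * n + 1) := by
    field_simp; ring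
  have e4 : (2 : ℝ[X]) * C (1 / 2) = 1 := by
    rw [← C_ofNat, ← C_mul]; norm_num
  rw [e2, C_add]
  simp only [derivative_mul, derivative_X, derivative_add, one_mul]
  linear_combination hB + X * hQ - derivative (besselPoly (n + 1)) * e4

/-- `q_n` is `1` plus `u` times a nonnegative combination of lower Bessel polynomials. Applying
`D - D²/2` reduces the identity for `n + 1` to the one for `n`, as the value at `0` is known. -/
theorem exists_besselPoly_eq_one_add_X_mul (n : ℕ) :
    ∃ c : ℕ → ℝ, (∀ i, 0 ≤ c i) ∧
      besselPoly n = 1 + X * ∑ i ∈ Finset.range n, C (c i) * besselPoly i := by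
  induction n with
  | zero => exact ⟨0, fun _ => le_rfl, by simp [besselPoly_zero]⟩
  | succ n ih =>
    obtain ⟨c, hc, hq⟩ := ih
    set r : ℝ := (n + 1) / (2 * n + 1) with hr
    -- The coefficients are scaled to compensate for the factors `(j + 2) / (2 j + 1)` by which
    -- `D - D²/2` maps `u q_{j+1}` to `u q_j`.
    let c' : ℕ → ℝ := fun i => Nat.casesOn i r fun j => r * c j * ((2 * j + 1) / (j + 2))
    have hc0 : c' 0 = r := rfl
    have hcs : ∀ j, c' (j + 1) = r * c j * ((2 * j + 1) / (j + 2)) := fun _ => rfl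
    clear_value c'
    refine ⟨c', fun i => ?_, ?_⟩
    · rcases i with _ | j
      · rw [hc0]
        positivity
      · rw [hcs]
        have := hc j
        positivity
    · apply eq_of_besselDelta_eq
      · rw [besselDelta_besselPoly_succ, ← hr, hq, Finset.sum_range_succ']
        have h1 : besselDelta (1 : ℝ[X]) = 0 := by simp [besselDelta_apply]
        have h2 : ∀ (a : ℝ) (f : ℝ[X]), besselDelta (C a * f) = C a * besselDelta f := by
          intro a f
          rw [← smul_eq_C_mul, map_smul, smul_eq_C_mul]
        rw [map_add, h1, mul_add X, map_add, Finset.mul_sum, Finset.mul_sum, map_sum]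
        simp only [mul_left_comm X, h2, besselDelta_X_mul_besselPoly_zero,
          besselDelta_X_mul_besselPoly_succ]
        rw [zero_add, mul_add, Finset.mul_sum, add_comm, hc0]
        refine congrArg₂ (· + ·) (Finset.sum_congr rfl fun i _ => ?_) rfl
        rw [hcs]
        simp only [← mul_assoc, ← C_mul]
        refine congrArg (fun z : ℝ => C z * X * besselPoly i) ?_
        have : (2 * i + 1 : ℝ) ≠ 0 := by positivity
        field_simp
      · simp [besselPoly_eval_zero]

/-! ### Nonnegativity of the linearization coefficients -/

/-- `f` is a nonnegative combination of the Bessel polynomials `q_k` with `s ≤ k ≤ t`. -/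
def IsBesselCombination (s t : ℕ) (f : ℝ[X]) : Prop :=
  ∀ k, 0 ≤ besselBasis.repr f k ∧ (besselBasis.repr f k ≠ 0 → s ≤ k ∧ k ≤ t)

namespace IsBesselCombination

variable {s t s' t' : ℕ} {f g : ℝ[X]}

theorem mono (h : IsBesselCombination s t f) (hs : s' ≤ s) (ht : t ≤ t') :
    IsBesselCombination s' t' f := fun k =>
  ⟨(h k).1, fun hk => ⟨hs.trans ((h k).2 hk).1, ((h k).2 hk).2.trans ht⟩⟩

theorem besselPoly (n : ℕ) : IsBesselCombination n n (besselPoly n) := by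
  intro k
  rw [← besselBasis_apply, Module.Basis.repr_self, Finsupp.single_apply]
  split_ifs with h
  · subst h; simp
  · simp

theorem add (hf : IsBesselCombination s t f) (hg : IsBesselCombination s t g) :
    IsBesselCombination s t (f + g) := by
  intro k
  rw [map_add, Finsupp.add_apply]
  refine ⟨add_nonneg (hf k).1 (hg k).1, fun h => ?_⟩
  by_cases h0 : besselBasis.repr f k = 0
  · rw [h0, zero_add] at h
    exact (hg k).2 h
  · exact (hf k).2 h0

theorem C_mul (hf : IsBesselCombination s t f) {c : ℝ} (hc : 0 ≤ c) :
    IsBesselCombination s t (C c * f) := by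
  intro k
  rw [← smul_eq_C_mul, map_smul, Finsupp.smul_apply, smul_eq_mul]
  exact ⟨mul_nonneg hc (hf k).1, fun h => (hf k).2 (right_ne_zero_of_mul h)⟩

theorem sum {ι : Type*} {S : Finset ι} {F : ι → ℝ[X]}
    (h : ∀ i ∈ S, IsBesselCombination s t (F i)) :
    IsBesselCombination s t (∑ i ∈ S, F i) := by
  classical
  induction S using Finset.induction_on with
  | empty => intro k; simp
  | insert i S hi ih =>
    rw [Finset.sum_insert hi]
    exact (h i (by simp)).add (ih fun j hj => h j (by simp [hj]))

end IsBesselCombination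

/-- The linear map `L` with `L q_k = (2k+1) q_{k+1}`. It solves `(1 - D) (L f) = u f`. -/
noncomputable def besselLift : ℝ[X] →ₗ[ℝ] ℝ[X] :=
  besselBasis.constr ℝ fun k => C (2 * (k : ℝ) + 1) * besselPoly (k + 1)

theorem besselLift_besselPoly (k : ℕ) :
    besselLift (besselPoly k) = C (2 * (k : ℝ) + 1) * besselPoly (k + 1) := by
  rw [← besselBasis_apply, besselLift, Module.Basis.constr_basis]

theorem besselLift_sub_derivative (f : ℝ[X]) :
    besselLift f - derivative (besselLift f) = X * f := by
  have : besselLift - derivative ∘ₗ besselLift = LinearMap.mulLeft ℝ X := by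
    apply besselBasis.ext
    intro k
    have h := besselPoly_succ_sub_derivative k
    have hk : C (2 * (k : ℝ) + 1) * C (1 / (2 * (k : ℝ) + 1)) = 1 := by
      rw [← C_mul, mul_one_div_cancel (by positivity), C_1]
    simp only [besselBasis_apply, LinearMap.sub_apply, LinearMap.comp_apply,
      besselLift_besselPoly, derivative_C_mul, LinearMap.mulLeft_apply]
    linear_combination C (2 * (k : ℝ) + 1) * h + (X * besselPoly k) * hk
  exact LinearMap.congr_fun this f

theorem IsBesselCombination.besselLift {s t : ℕ} {f : ℝ[X]} (h : IsBesselCombination s t f) :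
    IsBesselCombination (s + 1) (t + 1) (besselLift f) := by
  rw [← besselBasis.linearCombination_repr f, Finsupp.linearCombination_apply, Finsupp.sum,
    map_sum]
  apply IsBesselCombination.sum
  intro k hk
  have hk' := (h k).2 (Finsupp.mem_support_iff.mp hk)
  rw [map_smul, besselBasis_apply, besselLift_besselPoly, smul_eq_C_mul]
  exact (((IsBesselCombination.besselPoly (k + 1)).mono (by omega) (by omega)).C_mul
    (by positivity)).C_mul (h k).1

/-- As `1 - D` is injective, `f` is determined by `(1 - D) f`: from `(1 - D) f = c + u g` one reads
off `f = c + L g`, and `L` preserves nonnegativity of Bessel coefficients. -/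
theorem eq_C_add_besselLift {f g : ℝ[X]} {c : ℝ} (h : f - derivative f = C c + X * g) :
    f = C c + besselLift g := by
  rw [← sub_eq_zero]
  apply eq_zero_of_eq_C_mul_derivative (c := 1)
  have h1 := besselLift_sub_derivative g
  simp only [C_1, derivative_sub, derivative_add, derivative_C]
  linear_combination h - h1

theorem derivative_comp_C_mul_X (f : ℝ[X]) (a : ℝ) :
    derivative (f.comp (C a * X)) = C a * (derivative f).comp (C a * X) := by
  rw [derivative_comp]; simp

/-- The differential recurrence for the dilated Bessel polynomial `q_{n+1}(a u)`. -/
theorem besselPoly_succ_comp_sub_derivative (n : ℕ) (a : ℝ) :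
    C a * (besselPoly (n + 1)).comp (C a * X) -
        derivative ((besselPoly (n + 1)).comp (C a * X)) =
      X * (C (a ^ 2 / (2 * n + 1)) * (besselPoly n).comp (C a * X)) := by
  have h := congrArg (fun p => p.comp (C a * X)) (besselPoly_succ_sub_derivative n)
  simp only [sub_comp, mul_comp, C_comp, X_comp] at h
  rw [derivative_comp_C_mul_X, div_eq_mul_one_div, C_mul, C_pow]
  linear_combination C a * h

/-- Dilating a Bessel polynomial by `a ∈ [0, 1]` gives a nonnegative combination of Bessel
polynomials. Here `(1 - D) q_{n+1}(a u) = (1 - a) q_{n+1}(a u) + a² u q_n(a u) / (2n+1)`, and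
expanding the first term as `1` plus `u` times lower polynomials makes the induction work. -/
theorem isBesselCombination_comp (n : ℕ) {a : ℝ} (h0 : 0 ≤ a) (h1 : a ≤ 1) :
    IsBesselCombination 0 n ((besselPoly n).comp (C a * X)) := by
  induction n using Nat.strong_induction_on with
  | _ n ih =>
    rcases n with _ | n
    · have h := IsBesselCombination.besselPoly 0
      rw [besselPoly_zero] at h ⊢
      simpa using h
    obtain ⟨c, hc, hq⟩ := exists_besselPoly_eq_one_add_X_mul (n + 1)
    have hq' := congrArg (fun p => p.comp (C a * X)) hq
    simp only [add_comp, one_comp, mul_comp, X_comp, sum_comp, C_comp] at hq'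
    have hd := besselPoly_succ_comp_sub_derivative n a
    have hb : 0 ≤ 1 - a := sub_nonneg.mpr h1
    rw [eq_C_add_besselLift (f := (besselPoly (n + 1)).comp (C a * X)) (c := 1 - a)
      (g := C ((1 - a) * a) * ∑ i ∈ Finset.range (n + 1), C (c i) * (besselPoly i).comp (C a * X) +
        C (a ^ 2 / (2 * n + 1)) * (besselPoly n).comp (C a * X))]
    · refine IsBesselCombination.add ?_ ((IsBesselCombination.mono (t' := n) (s' := 0)
        (s := 0) (t := n) ?_ le_rfl le_rfl).besselLift.mono (Nat.zero_le _) le_rfl)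
      · have h := (IsBesselCombination.besselPoly 0).C_mul hb
        rw [besselPoly_zero, mul_one] at h
        exact h.mono le_rfl (Nat.zero_le _)
      · refine IsBesselCombination.add (IsBesselCombination.C_mul (.sum fun i hi => ?_)
          (mul_nonneg hb h0)) ((ih n (Nat.lt_succ_self n)).C_mul (by positivity))
        have hi' := Finset.mem_range.mp hi
        exact ((ih i hi').mono le_rfl (by omega)).C_mul (hc i)
    · rw [C_mul]
      simp only [C_sub, C_1]
      linear_combination hd + (1 - C a) * hq'

/-- The product linearization. Applying `1 - D` to the product for `(n+1, m+1)` gives `u` times a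
nonnegative combination of the products for `(n, m+1)` and `(n+1, m)`, since `a + b = 1`. -/
theorem isBesselCombination_comp_mul_comp {a b : ℝ} (ha : 0 ≤ a) (hb : 0 ≤ b) (hab : a + b = 1)
    (n m : ℕ) :
    IsBesselCombination (min n m) (n + m)
      ((besselPoly n).comp (C a * X) * (besselPoly m).comp (C b * X)) := by
  induction n generalizing m with
  | zero =>
    rw [besselPoly_zero, one_comp, one_mul, zero_add, Nat.zero_min]
    exact isBesselCombination_comp m hb (by linarith)
  | succ n ihn =>
    induction m with
    | zero =>
      rw [besselPoly_zero, one_comp, mul_one, add_zero, Nat.min_zero]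
      exact isBesselCombination_comp (n + 1) ha (by linarith)
    | succ m ihm =>
      have hA := besselPoly_succ_comp_sub_derivative n a
      have hB := besselPoly_succ_comp_sub_derivative m b
      have hC : C a + C b = (1 : ℝ[X]) := by rw [← C_add, hab, C_1]
      have key := eq_C_add_besselLift (c := 0)
        (f := (besselPoly (n + 1)).comp (C a * X) * (besselPoly (m + 1)).comp (C b * X))
        (g := C (a ^ 2 / (2 * n + 1)) *
            ((besselPoly n).comp (C a * X) * (besselPoly (m + 1)).comp (C b * X)) +
          C (b ^ 2 / (2 * m + 1)) *
            ((besselPoly (n + 1)).comp (C a * X) * (besselPoly m).comp (C b * X))) (by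
          rw [derivative_mul, C_0]
          linear_combination (besselPoly (m + 1)).comp (C b * X) * hA +
            (besselPoly (n + 1)).comp (C a * X) * hB -
            ((besselPoly (n + 1)).comp (C a * X) * (besselPoly (m + 1)).comp (C b * X)) * hC)
      rw [key, C_0, zero_add]
      have h1 := ((ihn (m + 1)).mono (s' := min n m) (t' := n + m + 1)
        (by omega) (by omega)).C_mul (c := a ^ 2 / (2 * n + 1)) (by positivity)
      have h2 := (ihm.mono (s' := min n m) (t' := n + m + 1)
        (by omega) (by omega)).C_mul (c := b ^ 2 / (2 * m + 1)) (by positivity)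
      exact (h1.add h2).besselLift.mono (by omega) (by omega)

theorem IsBesselCombination.eq_sum {s t : ℕ} {f : ℝ[X]} (h : IsBesselCombination s t f) :
    f = ∑ k ∈ Finset.Icc s t, C (besselBasis.repr f k) * _root_.besselPoly k := by
  conv_lhs => rw [← besselBasis.linearCombination_repr f, Finsupp.linearCombination_apply]
  rw [Finsupp.sum_of_support_subset (s := Finset.Icc s t)]
  · simp only [besselBasis_apply, smul_eq_C_mul]
  · intro k hk
    exact Finset.mem_Icc.mpr ((h k).2 (Finsupp.mem_support_iff.mp hk))
  · simp

theorem linCoeff_nonneg {a : ℝ} (h0 : 0 ≤ a) (h1 : a ≤ 1) (n m k : ℕ) :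
    0 ≤ linCoeff n m a k :=
  (isBesselCombination_comp_mul_comp h0 (sub_nonneg.mpr h1) (add_sub_cancel _ _) n m k).1

theorem besselPoly_eval_mul_eval {a : ℝ} (h0 : 0 ≤ a) (h1 : a ≤ 1) (n m : ℕ) (u : ℝ) :
    (besselPoly n).eval (a * u) * (besselPoly m).eval ((1 - a) * u) =
      ∑ k ∈ Finset.Icc (min n m) (n + m), linCoeff n m a k * (besselPoly k).eval u := by
  have h := congrArg (eval u) (isBesselCombination_comp_mul_comp h0 (sub_nonneg.mpr h1)
    (add_sub_cancel _ _) n m).eq_sum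
  simpa [eval_comp, eval_finsetSum, linCoeff] using h

theorem sum_linCoeff {a : ℝ} (h0 : 0 ≤ a) (h1 : a ≤ 1) (n m : ℕ) :
    ∑ k ∈ Finset.Icc (min n m) (n + m), linCoeff n m a k = 1 := by
  have h := besselPoly_eval_mul_eval h0 h1 n m 0
  simpa [besselPoly_eval_zero] using h.symm

/-! ### The Macdonald function -/

theorem one_add_sq_div_two_le_cosh (t : ℝ) : 1 + t ^ 2 / 2 ≤ Real.cosh t := by
  have h1 : |t / 2| ≤ |Real.sinh (t / 2)| := by
    rw [Real.abs_sinh]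
    exact Real.self_le_sinh_iff.mpr (abs_nonneg _)
  have h2 := sq_le_sq.mpr h1
  have h3 := Real.cosh_two_mul (t / 2)
  have h4 := Real.cosh_sq (t / 2)
  rw [mul_div_cancel₀ t (two_ne_zero)] at h3
  rw [h3, h4]
  linarith

theorem integrable_exp_neg_mul_cosh_add {u : ℝ} (hu : 0 < u) (ν : ℝ) :
    Integrable fun t : ℝ => Real.exp (-u * Real.cosh t + ν * t) := by
  refine ((integrable_exp_neg_mul_sq (b := u / 4) (by positivity)).const_mul
    (Real.exp (ν ^ 2 / u))).mono' (by fun_prop) (Filter.Eventually.of_forall fun t => ?_)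
  rw [Real.norm_eq_abs, Real.abs_exp, ← Real.exp_add, Real.exp_le_exp]
  have h1 := mul_le_mul_of_nonneg_left (one_add_sq_div_two_le_cosh t) hu.le
  -- Complete the square: `u t² / 4 - ν t + ν² / u = (u t / 2 - ν)² / u`.
  have h2 : 0 ≤ (u * t / 2 - ν) ^ 2 / u := by positivity
  have h3 : (u * t / 2 - ν) ^ 2 / u = u * t ^ 2 / 4 - ν * t + ν ^ 2 / u := by
    field_simp; ring
  linarith

theorem macdonaldK_neg (ν u : ℝ) : macdonaldK (-ν) u = macdonaldK ν u := by
  simp [macdonaldK]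

/-- `2 K_ν` as an integral over the whole line, where integration by parts has no boundary terms. -/
theorem integral_exp_neg_mul_cosh_add {u : ℝ} (hu : 0 < u) (ν : ℝ) :
    ∫ t : ℝ, Real.exp (-u * Real.cosh t + ν * t) = 2 * macdonaldK ν u := by
  have h1 := integral_neg_eq_self (fun t : ℝ => Real.exp (-u * Real.cosh t + ν * t)) volume
  have h2 := integral_comp_abs (f := fun t => Real.exp (-u * Real.cosh t) * Real.cosh (ν * t))
  have h3 : ∀ t : ℝ, Real.exp (-u * Real.cosh |t|) * Real.cosh (ν * |t|) =
      (Real.exp (-u * Real.cosh t + ν * t) + Real.exp (-u * Real.cosh t + -ν * t)) / 2 := by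
    intro t
    have : Real.cosh (ν * |t|) = Real.cosh (ν * t) := by
      rw [← Real.cosh_abs, ← Real.cosh_abs (ν * t), abs_mul, abs_abs, abs_mul]
    rw [Real.cosh_abs, this, Real.cosh_eq (ν * t), Real.exp_add, Real.exp_add, neg_mul ν t]
    ring
  simp only [h3] at h2
  rw [integral_div, integral_add (integrable_exp_neg_mul_cosh_add hu ν)
    (integrable_exp_neg_mul_cosh_add hu (-ν))] at h2
  simp only [Real.cosh_neg, mul_neg, ← neg_mul] at h1
  rw [macdonaldK, ← h2, h1]
  ring

/-- The recurrence `K_{ν+1} = K_{ν-1} + (2ν/u) K_ν`: the derivative of `exp(-u cosh t + ν t)`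
integrates to zero. -/
theorem macdonaldK_add_one {u : ℝ} (hu : 0 < u) (ν : ℝ) :
    macdonaldK (ν + 1) u = macdonaldK (ν - 1) u + 2 * ν / u * macdonaldK ν u := by
  have hd : ∀ t : ℝ, HasDerivAt (fun t : ℝ => Real.exp (-u * Real.cosh t + ν * t))
      (-(u / 2) * (Real.exp (-u * Real.cosh t + (ν + 1) * t) -
        Real.exp (-u * Real.cosh t + (ν - 1) * t)) +
        ν * Real.exp (-u * Real.cosh t + ν * t)) t := by
    intro t
    have h : HasDerivAt (fun t : ℝ => Real.exp (-u * Real.cosh t + ν * t))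
        (Real.exp (-u * Real.cosh t + ν * t) * (-u * Real.sinh t + ν * 1)) t :=
      (((Real.hasDerivAt_cosh t).const_mul (-u)).add ((hasDerivAt_id t).const_mul ν)).exp
    convert h using 1
    have e1 : -u * Real.cosh t + (ν + 1) * t = -u * Real.cosh t + ν * t + t := by ring
    have e2 : -u * Real.cosh t + (ν - 1) * t = -u * Real.cosh t + ν * t + -t := by ring
    rw [e1, e2, Real.exp_add _ t, Real.exp_add _ (-t), Real.sinh_eq]
    ring
  have i0 := integrable_exp_neg_mul_cosh_add hu ν
  have i1 := integrable_exp_neg_mul_cosh_add hu (ν + 1)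
  have i2 := integrable_exp_neg_mul_cosh_add hu (ν - 1)
  have i3 : Integrable fun t : ℝ => Real.exp (-u * Real.cosh t + (ν + 1) * t) -
      Real.exp (-u * Real.cosh t + (ν - 1) * t) := i1.sub i2
  have h := integral_eq_zero_of_hasDerivAt_of_integrable hd
    ((i3.const_mul _).add (i0.const_mul _)) i0
  rw [integral_add (i3.const_mul _) (i0.const_mul _), integral_const_mul,
    integral_const_mul, integral_sub i1 i2, integral_exp_neg_mul_cosh_add hu,
    integral_exp_neg_mul_cosh_add hu, integral_exp_neg_mul_cosh_add hu] at h
  field_simp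
  linarith

/-- `K_{1/2}` is elementary: substitute `v = sinh (t/2)`, so that `cosh t = 1 + 2 v²`. -/
theorem macdonaldK_one_half (u : ℝ) :
    macdonaldK (1 / 2) u = Real.sqrt (Real.pi / (2 * u)) * Real.exp (-u) := by
  have h2 := integral_comp_abs
    (f := fun t => Real.exp (-u * Real.cosh t) * Real.cosh (1 / 2 * t))
  have hd : ∀ t : ℝ, HasDerivAt (fun t : ℝ => Real.sinh (1 / 2 * t))
      (Real.cosh (1 / 2 * t) * (1 / 2)) t := by
    intro t
    simpa using ((hasDerivAt_id t).const_mul (1 / 2 : ℝ)).sinh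
  have himg : (fun t : ℝ => Real.sinh (1 / 2 * t)) '' Set.univ = Set.univ := by
    rw [Set.image_univ, Set.range_eq_univ]
    intro y
    obtain ⟨x, hx⟩ := Real.sinh_surjective y
    exact ⟨2 * x, by simp [hx]⟩
  have hinj : Set.InjOn (fun t : ℝ => Real.sinh (1 / 2 * t)) Set.univ := by
    intro x _ y _ hxy
    have := Real.sinh_injective hxy
    linarith
  have h3 := integral_image_eq_integral_abs_deriv_smul MeasurableSet.univ
    (fun t _ => (hd t).hasDerivWithinAt) hinj (fun v : ℝ => Real.exp (-(2 * u) * v ^ 2))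
  rw [himg, setIntegral_univ, setIntegral_univ, integral_gaussian] at h3
  rw [macdonaldK]
  have h4 : ∀ t : ℝ, Real.exp (-u * Real.cosh |t|) * Real.cosh (1 / 2 * |t|) =
      2 * Real.exp (-u) * (|Real.cosh (1 / 2 * t) * (1 / 2)| •
        Real.exp (-(2 * u) * Real.sinh (1 / 2 * t) ^ 2)) := by
    intro t
    have e1 : Real.cosh (1 / 2 * |t|) = Real.cosh (1 / 2 * t) := by
      rw [← Real.cosh_abs (1 / 2 * t), abs_mul, abs_of_pos (by norm_num : (0 : ℝ) < 1 / 2)]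
    have e2 : Real.cosh t = 1 + 2 * Real.sinh (1 / 2 * t) ^ 2 := by
      have h3 := Real.cosh_two_mul (1 / 2 * t)
      have h4 := Real.cosh_sq (1 / 2 * t)
      rw [h4, ← mul_assoc, mul_one_div_cancel two_ne_zero, one_mul] at h3
      linarith
    have e3 : -u * Real.cosh t = -u + -(2 * u) * Real.sinh (1 / 2 * t) ^ 2 := by
      rw [e2]; ring
    rw [e1, Real.cosh_abs, e3, Real.exp_add, smul_eq_mul,
      abs_of_pos (mul_pos (Real.cosh_pos _) (by norm_num))]
    ring
  simp only [h4] at h2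
  rw [integral_const_mul, ← h3] at h2
  linarith

theorem studentK_of_pos {u : ℝ} (hu : 0 < u) (ν : ℝ) :
    studentK ν u = 2 ^ (1 - ν) / Real.Gamma ν * u ^ ν * macdonaldK ν u := if_neg hu.ne'

theorem studentK_add_one {u ν : ℝ} (hu : 0 < u) (hν : 0 < ν) :
    studentK (ν + 1) u =
      2 ^ (-ν) / (ν * Real.Gamma ν) * (u ^ ν * u) * macdonaldK (ν + 1) u := by
  rw [studentK_of_pos hu, Real.Gamma_add_one hν.ne', Real.rpow_add_one hu.ne']
  congr 4
  ring

/-- The three-term recurrence of `k_ν`; at `ν = n + 1/2` it is that of the Bessel polynomials. -/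
theorem studentK_add_two {u ν : ℝ} (hu : 0 < u) (hν : 0 < ν) :
    studentK (ν + 2) u =
      studentK (ν + 1) u + 1 / (4 * ν * (ν + 1)) * (u ^ 2 * studentK ν u) := by
  have h := macdonaldK_add_one hu (ν + 1)
  rw [add_sub_cancel_right] at h
  have e : ν + 2 = ν + 1 + 1 := by ring
  rw [e, studentK_add_one hu (by linarith : 0 < ν + 1), studentK_add_one hu hν, h,
    studentK_of_pos hu, Real.Gamma_add_one hν.ne', Real.rpow_add_one hu.ne',
    show (2 : ℝ) ^ (1 - ν) = 2 * 2 ^ (-ν) by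
      rw [sub_eq_add_neg, Real.rpow_add two_pos, Real.rpow_one],
    show (2 : ℝ) ^ (-(ν + 1)) = 2 ^ (-ν) / 2 by
      rw [neg_add, ← sub_eq_add_neg, Real.rpow_sub two_pos, Real.rpow_one]]
  have hG := (Real.Gamma_pos_of_pos hν).ne'
  have hν1 : ν + 1 ≠ 0 := by positivity
  have hν0 := hν.ne'
  field_simp
  ring

theorem studentK_one_half {u : ℝ} (hu : 0 < u) : studentK (1 / 2) u = Real.exp (-u) := by
  have hp := Real.sqrt_pos.mpr Real.pi_pos
  have h2 := Real.sqrt_pos.mpr (two_pos (α := ℝ))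
  have hu' := Real.sqrt_pos.mpr hu
  rw [studentK_of_pos hu, macdonaldK_one_half u, Real.Gamma_one_half_eq,
    show (1 - 1 / 2 : ℝ) = 1 / 2 by norm_num, ← Real.sqrt_eq_rpow, ← Real.sqrt_eq_rpow,
    Real.sqrt_div Real.pi_pos.le, Real.sqrt_mul two_pos.le]
  field_simp

theorem studentK_three_halves {u : ℝ} (hu : 0 < u) :
    studentK (1 / 2 + 1) u = Real.exp (-u) * (1 + u) := by
  have h := macdonaldK_add_one hu (1 / 2)
  rw [show (1 / 2 - 1 : ℝ) = -(1 / 2) by norm_num, macdonaldK_neg] at h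
  have h1 := studentK_one_half hu
  rw [studentK_of_pos hu] at h1
  rw [studentK_add_one hu (by norm_num), h, ← h1,
    show (2 : ℝ) ^ (1 - 1 / 2 : ℝ) = 2 * 2 ^ (-(1 / 2) : ℝ) by
      rw [sub_eq_add_neg, Real.rpow_add two_pos, Real.rpow_one]]
  field_simp
  ring

/-- For half-integer index, `k_{n+1/2}(u) = e^{-u} q_n(u)`. -/
theorem studentK_nat_add_half (n : ℕ) {u : ℝ} (hu : 0 ≤ u) :
    studentK (n + 1 / 2) u = Real.exp (-u) * (besselPoly n).eval u := by
  rcases hu.eq_or_lt with rfl | hu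
  · simp [studentK, besselPoly_eval_zero]
  induction n using Nat.twoStepInduction with
  | zero => simpa [besselPoly_zero] using studentK_one_half hu
  | one =>
    have h1 : (besselPoly 1).eval u = 1 + u := by
      simp [besselPoly, Finset.sum_range_succ, besselCoeff]
    rw [h1, ← studentK_three_halves hu]
    congr 1
    push_cast
    ring
  | more n ih1 ih2 =>
    have h := studentK_add_two hu (by positivity : (0 : ℝ) < n + 1 / 2)
    have e1 : ((n + 2 : ℕ) : ℝ) + 1 / 2 = n + 1 / 2 + 2 := by push_cast; ring
    have e2 : ((n + 1 : ℕ) : ℝ) + 1 / 2 = n + 1 / 2 + 1 := by push_cast; ring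
    rw [e2] at ih2
    rw [e1, h, ih1, ih2, besselPoly_add_two]
    simp only [eval_add, eval_mul, eval_C, eval_pow, eval_X]
    rw [show (4 * (n + 1 / 2) * (n + 1 / 2 + 1) : ℝ) = (2 * n + 1) * (2 * n + 3) by ring]
    ring

/-! ### The characteristic function of the Student density -/

theorem studentDensity_nonneg (N : ℕ) {ν : ℝ} (hν : 0 < ν) (x : EuclideanSpace ℝ (Fin N)) :
    0 ≤ studentDensity N ν x := by
  have h1 := (Real.Gamma_pos_of_pos hν).le
  have h2 := (Real.Gamma_pos_of_pos (by positivity : 0 < ν + (N : ℝ) / 2)).le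
  have h3 := (Real.Gamma_pos_of_pos (by norm_num : (0 : ℝ) < 1 / 2)).le
  unfold studentDensity
  positivity

theorem continuous_studentDensity (N : ℕ) (ν : ℝ) : Continuous (studentDensity N ν) := by
  unfold studentDensity
  refine continuous_const.mul (Continuous.rpow_const (by fun_prop) fun x => Or.inl ?_)
  positivity

theorem studentDensity_le (N : ℕ) {ν : ℝ} (hν : 0 < ν) (x : EuclideanSpace ℝ (Fin N)) :
    studentDensity N ν x ≤ studentDensity N ν 0 := by
  have h1 := (Real.Gamma_pos_of_pos hν).le
  have h2 := (Real.Gamma_pos_of_pos (by positivity : 0 < ν + (N : ℝ) / 2)).le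
  have h3 := (Real.Gamma_pos_of_pos (by norm_num : (0 : ℝ) < 1 / 2)).le
  unfold studentDensity
  refine mul_le_mul_of_nonneg_left ?_ (by positivity)
  have h4 : -ν - (N : ℝ) / 2 ≤ 0 := by
    have : 0 ≤ (N : ℝ) / 2 := by positivity
    linarith
  simpa using Real.rpow_le_one_of_one_le_of_nonpos (le_add_of_nonneg_right (sq_nonneg ‖x‖)) h4

theorem integrable_one_add_norm_sq_rpow (N : ℕ) {ν : ℝ} (hν : 0 < ν) :
    Integrable fun x : EuclideanSpace ℝ (Fin N) => (1 + ‖x‖ ^ 2) ^ (-ν - (N : ℝ) / 2) := by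
  have h := integrable_rpow_neg_one_add_norm_sq (E := EuclideanSpace ℝ (Fin N))
    (μ := volume) (r := 2 * ν + N) (by simp [hν])
  rwa [show -(2 * ν + N) / 2 = -ν - (N : ℝ) / 2 by ring] at h

theorem integrable_studentDensity (N : ℕ) {ν : ℝ} (hν : 0 < ν) :
    Integrable (studentDensity N ν) :=
  (integrable_one_add_norm_sq_rpow N hν).const_mul _

/-- The function `k_ν` as a Laplace-type integral, via the substitution `r = (u/2) e^t`. -/
theorem integral_rpow_mul_exp_eq_studentK {ν u : ℝ} (hν : 0 < ν) (hu : 0 ≤ u) :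
    ∫ r in Set.Ioi (0 : ℝ), r ^ (ν - 1) * Real.exp (-r - u ^ 2 / (4 * r)) =
      Real.Gamma ν * studentK ν u := by
  rcases hu.eq_or_lt with rfl | hu
  · have h := Real.integral_rpow_mul_exp_neg_mul_Ioi hν one_pos
    simpa [studentK] using h
  have hd : ∀ t : ℝ, HasDerivAt (fun t : ℝ => u / 2 * Real.exp t) (u / 2 * Real.exp t) t :=
    fun t => (Real.hasDerivAt_exp t).const_mul _
  have himg : (fun t : ℝ => u / 2 * Real.exp t) '' Set.univ = Set.Ioi 0 := by
    rw [Set.image_univ]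
    ext y
    constructor
    · rintro ⟨t, rfl⟩
      exact mul_pos (half_pos hu) (Real.exp_pos t)
    · intro (hy : 0 < y)
      refine ⟨Real.log (y / (u / 2)), ?_⟩
      change u / 2 * Real.exp (Real.log (y / (u / 2))) = y
      rw [Real.exp_log (by positivity)]
      field_simp
  have hinj : Set.InjOn (fun t : ℝ => u / 2 * Real.exp t) Set.univ := fun x _ y _ hxy =>
    Real.exp_injective (mul_left_cancel₀ (half_pos hu).ne' hxy)
  have h := integral_image_eq_integral_abs_deriv_smul MeasurableSet.univ
    (fun t _ => (hd t).hasDerivWithinAt) hinj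
    (fun r : ℝ => r ^ (ν - 1) * Real.exp (-r - u ^ 2 / (4 * r)))
  rw [himg] at h
  rw [h, setIntegral_univ]
  have e : ∀ t : ℝ, |u / 2 * Real.exp t| • ((u / 2 * Real.exp t) ^ (ν - 1) *
      Real.exp (-(u / 2 * Real.exp t) - u ^ 2 / (4 * (u / 2 * Real.exp t)))) =
      (u / 2) ^ ν * Real.exp (-u * Real.cosh t + ν * t) := by
    intro t
    have hp : 0 < u / 2 * Real.exp t := mul_pos (half_pos hu) (Real.exp_pos t)
    have e1 : -(u / 2 * Real.exp t) - u ^ 2 / (4 * (u / 2 * Real.exp t)) =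
        -u * Real.cosh t := by
      rw [Real.cosh_eq, Real.exp_neg]
      field_simp
      ring
    have e2 : (u / 2 * Real.exp t) * (u / 2 * Real.exp t) ^ (ν - 1) =
        (u / 2) ^ ν * Real.exp (ν * t) := by
      rw [Real.rpow_sub_one hp.ne', mul_div_cancel₀ _ hp.ne',
        Real.mul_rpow (half_pos hu).le (Real.exp_pos t).le, ← Real.exp_mul, mul_comm t]
    rw [e1, abs_of_pos hp, smul_eq_mul, ← mul_assoc, e2, Real.exp_add]
    ring
  simp only [e]
  rw [integral_const_mul, integral_exp_neg_mul_cosh_add hu, studentK_of_pos hu,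
    Real.div_rpow hu.le two_pos.le, Real.rpow_sub two_pos, Real.rpow_one]
  have hG := (Real.Gamma_pos_of_pos hν).ne'
  field_simp

/-- The Fourier integral of the unnormalized Gaussian `exp(-r |x|²)` on `ℝ^N`. -/
theorem integral_cexp_inner_mul_exp_neg_mul_norm_sq (N : ℕ) {r : ℝ} (hr : 0 < r)
    (y : EuclideanSpace ℝ (Fin N)) :
    ∫ x : EuclideanSpace ℝ (Fin N), Complex.exp (Complex.I * ((inner ℝ x y : ℝ) : ℂ)) *
        (Real.exp (-(r * ‖x‖ ^ 2)) : ℂ) =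
      (((Real.pi / r) ^ ((N : ℝ) / 2) * Real.exp (-(‖y‖ ^ 2 / (4 * r))) : ℝ) : ℂ) := by
  have h := GaussianFourier.integral_cexp_neg_mul_sq_norm_add (b := (r : ℂ)) (by simpa using hr)
    Complex.I y
  rw [finrank_euclideanSpace_fin] at h
  calc _ = ∫ v : EuclideanSpace ℝ (Fin N),
        Complex.exp (-(r : ℂ) * ‖v‖ ^ 2 + Complex.I * ((inner ℝ y v : ℝ) : ℂ)) := by
        congr with v
        rw [Complex.exp_add, real_inner_comm, mul_comm]
        push_cast
        rw [neg_mul]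
    _ = _ := by
        rw [h, Complex.I_sq]
        push_cast
        rw [Complex.ofReal_cpow (by positivity)]
        push_cast
        congr 2
        ring

/-- `(1 + |x|²)^{-ν-N/2}` as a Gamma mixture of Gaussians. -/
theorem integral_rpow_mul_exp_neg_one_add_norm_sq (N : ℕ) {ν : ℝ} (hν : 0 < ν)
    (x : EuclideanSpace ℝ (Fin N)) :
    ∫ r in Set.Ioi (0 : ℝ), r ^ (ν + (N : ℝ) / 2 - 1) * Real.exp (-((1 + ‖x‖ ^ 2) * r)) =
      Real.Gamma (ν + (N : ℝ) / 2) * (1 + ‖x‖ ^ 2) ^ (-ν - (N : ℝ) / 2) := by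
  rw [Real.integral_rpow_mul_exp_neg_mul_Ioi (by positivity) (by positivity), mul_comm,
    one_div, Real.inv_rpow (by positivity), ← Real.rpow_neg (by positivity)]
  congr 2
  ring

/-- The Gamma mixture of Gaussians, times a character, is integrable jointly in the position and the
mixing variable; this justifies exchanging the two integrals. -/
theorem integrable_gaussian_mixture (N : ℕ) {ν : ℝ} (hν : 0 < ν)
    (y : EuclideanSpace ℝ (Fin N)) :
    Integrable (fun p : EuclideanSpace ℝ (Fin N) × ℝ =>
      Complex.exp (Complex.I * ((inner ℝ p.1 y : ℝ) : ℂ)) *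
        ((p.2 ^ (ν + (N : ℝ) / 2 - 1) * Real.exp (-((1 + ‖p.1‖ ^ 2) * p.2)) : ℝ) : ℂ))
      (volume.prod (volume.restrict (Set.Ioi (0 : ℝ)))) := by
  have hs : 0 < ν + (N : ℝ) / 2 := by positivity
  have hnorm : ∀ (x : EuclideanSpace ℝ (Fin N)) (r : ℝ), 0 < r →
      ‖Complex.exp (Complex.I * ((inner ℝ x y : ℝ) : ℂ)) *
        ((r ^ (ν + (N : ℝ) / 2 - 1) * Real.exp (-((1 + ‖x‖ ^ 2) * r)) : ℝ) : ℂ)‖ =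
      r ^ (ν + (N : ℝ) / 2 - 1) * Real.exp (-((1 + ‖x‖ ^ 2) * r)) := by
    intro x r hr
    rw [norm_mul, mul_comm Complex.I, Complex.norm_exp_ofReal_mul_I, one_mul, Complex.norm_real,
      Real.norm_of_nonneg (by positivity)]
  have hint : ∀ x : EuclideanSpace ℝ (Fin N), IntegrableOn
      (fun r => r ^ (ν + (N : ℝ) / 2 - 1) * Real.exp (-((1 + ‖x‖ ^ 2) * r))) (Set.Ioi 0) := by
    intro x
    -- A non-integrable function would have integral `0`, but the integral is positive.
    by_contra hni
    have h := integral_rpow_mul_exp_neg_one_add_norm_sq N hν x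
    rw [integral_undef hni] at h
    have : 0 < Real.Gamma (ν + (N : ℝ) / 2) * (1 + ‖x‖ ^ 2) ^ (-ν - (N : ℝ) / 2) :=
      mul_pos (Real.Gamma_pos_of_pos hs) (by positivity)
    exact this.ne h
  rw [integrable_prod_iff (by
    apply Measurable.aestronglyMeasurable
    fun_prop)]
  constructor
  · refine Filter.Eventually.of_forall fun x => ?_
    refine (hint x).mono' (by apply Measurable.aestronglyMeasurable; fun_prop) ?_
    filter_upwards [ae_restrict_mem measurableSet_Ioi] with r hr
    exact (hnorm x r hr).le
  · refine ((integrable_one_add_norm_sq_rpow N hν).const_mul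
      (Real.Gamma (ν + (N : ℝ) / 2))).congr (Filter.Eventually.of_forall fun x => ?_)
    change _ = ∫ r in Set.Ioi (0 : ℝ), _
    rw [setIntegral_congr_fun measurableSet_Ioi fun r hr => hnorm x r hr]
    exact (integral_rpow_mul_exp_neg_one_add_norm_sq N hν x).symm

/-- The characteristic function of the Student density. -/
theorem integral_cexp_mul_studentDensity (N : ℕ) {ν : ℝ} (hν : 0 < ν)
    (y : EuclideanSpace ℝ (Fin N)) :
    ∫ x, Complex.exp (Complex.I * ((inner ℝ x y : ℝ) : ℂ)) * (studentDensity N ν x : ℂ) =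
      (studentK ν ‖y‖ : ℂ) := by
  have hs : 0 < ν + (N : ℝ) / 2 := by positivity
  have hΓs := (Real.Gamma_pos_of_pos hs).ne'
  have hΓ := (Real.Gamma_pos_of_pos hν).ne'
  have hpi : Real.Gamma (1 / 2) ^ N = Real.pi ^ ((N : ℝ) / 2) := by
    rw [Real.Gamma_one_half_eq, Real.sqrt_eq_rpow, ← Real.rpow_natCast,
      ← Real.rpow_mul Real.pi_pos.le]
    congr 1
    ring
  have hpi0 : (0 : ℝ) < Real.pi ^ ((N : ℝ) / 2) := by positivity
  have h1 : ∀ x : EuclideanSpace ℝ (Fin N),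
      Complex.exp (Complex.I * ((inner ℝ x y : ℝ) : ℂ)) * (studentDensity N ν x : ℂ) =
      ((1 / (Real.Gamma ν * Real.pi ^ ((N : ℝ) / 2)) : ℝ) : ℂ) *
        ∫ r in Set.Ioi (0 : ℝ), Complex.exp (Complex.I * ((inner ℝ x y : ℝ) : ℂ)) *
          ((r ^ (ν + (N : ℝ) / 2 - 1) * Real.exp (-((1 + ‖x‖ ^ 2) * r)) : ℝ) : ℂ) := by
    intro x
    rw [integral_const_mul, integral_complex_ofReal,
      integral_rpow_mul_exp_neg_one_add_norm_sq N hν, mul_left_comm, ← Complex.ofReal_mul]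
    congr 2
    rw [studentDensity, hpi]
    field_simp
  have h2 : ∀ r ∈ Set.Ioi (0 : ℝ),
      ∫ x : EuclideanSpace ℝ (Fin N), Complex.exp (Complex.I * ((inner ℝ x y : ℝ) : ℂ)) *
          ((r ^ (ν + (N : ℝ) / 2 - 1) * Real.exp (-((1 + ‖x‖ ^ 2) * r)) : ℝ) : ℂ) =
      ((Real.pi ^ ((N : ℝ) / 2) *
        (r ^ (ν - 1) * Real.exp (-r - ‖y‖ ^ 2 / (4 * r))) : ℝ) : ℂ) := by
    intro r (hr : 0 < r)
    have e : ∀ x : EuclideanSpace ℝ (Fin N),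
        Complex.exp (Complex.I * ((inner ℝ x y : ℝ) : ℂ)) *
          ((r ^ (ν + (N : ℝ) / 2 - 1) * Real.exp (-((1 + ‖x‖ ^ 2) * r)) : ℝ) : ℂ) =
        ((r ^ (ν + (N : ℝ) / 2 - 1) * Real.exp (-r) : ℝ) : ℂ) *
          (Complex.exp (Complex.I * ((inner ℝ x y : ℝ) : ℂ)) *
            (Real.exp (-(r * ‖x‖ ^ 2)) : ℂ)) := by
      intro x
      rw [show -((1 + ‖x‖ ^ 2) * r) = -r + -(r * ‖x‖ ^ 2) by ring, Real.exp_add]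
      push_cast
      ring
    simp only [e]
    rw [integral_const_mul, integral_cexp_inner_mul_exp_neg_mul_norm_sq N hr,
      ← Complex.ofReal_mul]
    congr 1
    rw [Real.div_rpow Real.pi_pos.le hr.le, show ν + (N : ℝ) / 2 - 1 = ν - 1 + (N : ℝ) / 2 by ring,
      Real.rpow_add hr, sub_eq_add_neg (-r), Real.exp_add]
    have : r ^ ((N : ℝ) / 2) ≠ 0 := by positivity
    field_simp
  simp only [h1]
  rw [integral_const_mul, integral_integral_swap (integrable_gaussian_mixture N hν y),
    setIntegral_congr_fun measurableSet_Ioi h2, integral_complex_ofReal, integral_const_mul,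
    integral_rpow_mul_exp_eq_studentK hν (norm_nonneg y), ← Complex.ofReal_mul]
  congr 1
  field_simp

theorem integral_studentDensity (N : ℕ) {ν : ℝ} (hν : 0 < ν) :
    ∫ x, studentDensity N ν x = 1 := by
  have h := integral_cexp_mul_studentDensity N hν 0
  simp only [inner_zero_right, Complex.ofReal_zero, mul_zero, Complex.exp_zero, one_mul,
    norm_zero] at h
  rw [integral_complex_ofReal] at h
  have h1 : studentK ν 0 = 1 := if_pos rfl
  rw [h1] at h
  exact_mod_cast h

/-! ### Convolution of dilated Student densities -/

open scoped FourierTransform in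
/-- Uniqueness by Fourier inversion, applied to `f - g`, whose transform `0` is integrable. -/
theorem Continuous.eq_of_fourier_eq {V : Type*} [NormedAddCommGroup V] [InnerProductSpace ℝ V]
    [FiniteDimensional ℝ V] [MeasurableSpace V] [BorelSpace V] {f g : V → ℂ}
    (hf : Continuous f) (hg : Continuous g) (hfi : Integrable f) (hgi : Integrable g)
    (h : 𝓕 f = 𝓕 g) : f = g := by
  have h0 : 𝓕 (f - g) = 0 := by
    ext w
    have h1 : 𝓕 f w = 𝓕 g w := congrFun h w
    rw [Real.fourier_eq, Real.fourier_eq] at h1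
    rw [Real.fourier_eq]
    simp only [Pi.sub_apply, smul_sub]
    rw [integral_sub ((Real.fourierIntegral_convergent_iff w).2 hfi)
      ((Real.fourierIntegral_convergent_iff w).2 hgi), h1, sub_self, Pi.zero_apply]
  have h2 := (hf.sub hg).fourierInv_fourier_eq (hfi.sub hgi)
    (by rw [h0]; exact integrable_zero _ _ _)
  rw [h0] at h2
  rw [← sub_eq_zero, ← h2]
  ext w
  simp [Real.fourierInv_eq]

open scoped FourierTransform in
theorem fourier_eq_integral_cexp_mul {V : Type*} [NormedAddCommGroup V] [InnerProductSpace ℝ V]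
    [FiniteDimensional ℝ V] [MeasurableSpace V] [BorelSpace V] (f : V → ℂ) (w : V) :
    𝓕 f w = ∫ x, Complex.exp (Complex.I * ((inner ℝ x ((-2 * Real.pi) • w) : ℝ) : ℂ)) * f x := by
  rw [Real.fourier_eq']
  simp only [real_inner_smul_right, smul_eq_mul, mul_comm Complex.I]

/-- The dilation `x ↦ a^{-N} f_{N,ν}(x/a)` of the Student density. -/
noncomputable def scaledStudentDensity (N : ℕ) (ν a : ℝ) (x : EuclideanSpace ℝ (Fin N)) : ℝ :=
  1 / a ^ N * studentDensity N ν (a⁻¹ • x)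

theorem continuous_scaledStudentDensity (N : ℕ) (ν a : ℝ) :
    Continuous (scaledStudentDensity N ν a) :=
  continuous_const.mul ((continuous_studentDensity N ν).comp (continuous_const_smul _))

theorem integrable_scaledStudentDensity (N : ℕ) {ν a : ℝ} (hν : 0 < ν) (ha : 0 < a) :
    Integrable (scaledStudentDensity N ν a) :=
  ((integrable_studentDensity N hν).comp_smul (inv_ne_zero ha.ne')).const_mul _

theorem bddAbove_norm_scaledStudentDensity (N : ℕ) {ν a : ℝ} (hν : 0 < ν) (ha : 0 < a) :
    BddAbove (Set.range fun x => ‖scaledStudentDensity N ν a x‖) := by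
  refine ⟨1 / a ^ N * studentDensity N ν 0, ?_⟩
  rintro _ ⟨x, rfl⟩
  have h := studentDensity_nonneg N hν (a⁻¹ • x)
  change ‖1 / a ^ N * studentDensity N ν (a⁻¹ • x)‖ ≤ _
  rw [Real.norm_of_nonneg (by positivity)]
  exact mul_le_mul_of_nonneg_left (studentDensity_le N hν _) (by positivity)

theorem integral_cexp_mul_scaledStudentDensity (N : ℕ) {ν a : ℝ} (hν : 0 < ν) (ha : 0 < a)
    (y : EuclideanSpace ℝ (Fin N)) :
    ∫ x, Complex.exp (Complex.I * ((inner ℝ x y : ℝ) : ℂ)) * (scaledStudentDensity N ν a x : ℂ) =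
      (studentK ν (a * ‖y‖) : ℂ) := by
  have h := Measure.integral_comp_inv_smul_of_nonneg volume
    (fun x : EuclideanSpace ℝ (Fin N) =>
      Complex.exp (Complex.I * ((inner ℝ x (a • y) : ℝ) : ℂ)) * (studentDensity N ν x : ℂ)) ha.le
  rw [integral_cexp_mul_studentDensity N hν, finrank_euclideanSpace_fin, norm_smul,
    Real.norm_of_nonneg ha.le] at h
  have haN : ((a ^ N : ℝ) : ℂ) ≠ 0 := by
    exact_mod_cast (pow_pos ha N).ne'
  calc _ = ∫ x : EuclideanSpace ℝ (Fin N), (((a ^ N : ℝ) : ℂ))⁻¹ *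
        (Complex.exp (Complex.I * ((inner ℝ (a⁻¹ • x) (a • y) : ℝ) : ℂ)) *
          (studentDensity N ν (a⁻¹ • x) : ℂ)) := by
        congr with x
        rw [real_inner_smul_left, real_inner_smul_right, inv_mul_cancel_left₀ ha.ne',
          scaledStudentDensity]
        push_cast
        ring
    _ = _ := by
        rw [integral_const_mul, h, Complex.real_smul, inv_mul_cancel_left₀ haN]

theorem convolutionExists_scaledStudentDensity (N : ℕ) {ν μ a b : ℝ} (hν : 0 < ν) (hμ : 0 < μ)
    (ha : 0 < a) (hb : 0 < b) :
    ConvolutionExists (scaledStudentDensity N ν a) (scaledStudentDensity N μ b)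
      (ContinuousLinearMap.mul ℝ ℝ) volume := fun _ =>
  BddAbove.convolutionExistsAt (s := Set.univ) _
    ((bddAbove_norm_scaledStudentDensity N hμ hb).mono (Set.image_subset_range _ _))
    MeasurableSet.univ (Set.subset_univ _)
    (integrable_scaledStudentDensity N hν ha).integrableOn
    (continuous_scaledStudentDensity N μ b).aestronglyMeasurable

theorem ofReal_convolution {V : Type*} [NormedAddCommGroup V] [MeasurableSpace V]
    {μ : Measure V} (f g : V → ℝ) (x : V) :
    (((f ⋆[ContinuousLinearMap.mul ℝ ℝ, μ] g) x : ℝ) : ℂ) =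
      ((fun x => (f x : ℂ)) ⋆[ContinuousLinearMap.mul ℂ ℂ, μ] fun x => (g x : ℂ)) x := by
  simp only [convolution_def, ContinuousLinearMap.mul_apply']
  rw [← integral_complex_ofReal]
  simp

open scoped FourierTransform in
/-- Convolutions of dilated Student densities of half-integer index: both sides are continuous and
integrable, and their characteristic functions agree by the linearization formula. -/
theorem convolution_scaledStudentDensity (N n m : ℕ) {a : ℝ} (ha : 0 < a) (ha1 : a < 1)
    (x : EuclideanSpace ℝ (Fin N)) :
    (scaledStudentDensity N (n + 1 / 2) a ⋆[ContinuousLinearMap.mul ℝ ℝ, volume]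
      scaledStudentDensity N (m + 1 / 2) (1 - a)) x =
    ∑ k ∈ Finset.Icc (min n m) (n + m), linCoeff n m a k * studentDensity N (k + 1 / 2) x := by
  have hb : 0 < 1 - a := sub_pos.mpr ha1
  have hpos : ∀ k : ℕ, (0 : ℝ) < k + 1 / 2 := fun k => by positivity
  have hf := integrable_scaledStudentDensity N (hpos n) ha
  have hg := integrable_scaledStudentDensity N (hpos m) hb
  have hk : ∀ k : ℕ, Integrable fun x : EuclideanSpace ℝ (Fin N) =>
      ((linCoeff n m a k * studentDensity N (k + 1 / 2) x : ℝ) : ℂ) := fun k =>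
    ((integrable_studentDensity N (hpos k)).const_mul _).ofReal
  set F : EuclideanSpace ℝ (Fin N) → ℝ :=
    scaledStudentDensity N (n + 1 / 2) a ⋆[ContinuousLinearMap.mul ℝ ℝ, volume]
      scaledStudentDensity N (m + 1 / 2) (1 - a)
  have key : (fun x => (F x : ℂ)) = fun x => ∑ k ∈ Finset.Icc (min n m) (n + m),
      ((linCoeff n m a k * studentDensity N (k + 1 / 2) x : ℝ) : ℂ) := by
    apply Continuous.eq_of_fourier_eq
    · exact Complex.continuous_ofReal.comp
        (BddAbove.continuous_convolution_right_of_integrable _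
          (bddAbove_norm_scaledStudentDensity N (hpos m) hb) hf
          (continuous_scaledStudentDensity N _ _))
    · exact continuous_finsetSum _ fun k _ =>
        Complex.continuous_ofReal.comp (continuous_const.mul (continuous_studentDensity N _))
    · exact (hf.integrable_convolution _ hg).ofReal
    · exact integrable_finsetSum _ fun k _ => hk k
    · ext w
      have e : (fun x => (F x : ℂ)) =
          (fun x => (scaledStudentDensity N (n + 1 / 2) a x : ℂ))
            ⋆[ContinuousLinearMap.mul ℂ ℂ, volume]
          fun x => (scaledStudentDensity N (m + 1 / 2) (1 - a) x : ℂ) :=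
        funext fun x => ofReal_convolution _ _ x
      rw [e]
      refine (Real.fourier_mul_convolution_eq (R := ℂ)
        (f₁ := fun x => (scaledStudentDensity N (n + 1 / 2) a x : ℂ))
        (f₂ := fun x => (scaledStudentDensity N (m + 1 / 2) (1 - a) x : ℂ))
        hf.ofReal hg.ofReal w).trans ?_
      simp only [fourier_eq_integral_cexp_mul]
      set y := (-2 * Real.pi) • w
      rw [integral_cexp_mul_scaledStudentDensity N (hpos n) ha,
        integral_cexp_mul_scaledStudentDensity N (hpos m) hb]
      have hbdd : ∀ k : ℕ, Integrable fun x : EuclideanSpace ℝ (Fin N) =>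
          Complex.exp (Complex.I * ((inner ℝ x y : ℝ) : ℂ)) *
            ((linCoeff n m a k * studentDensity N (k + 1 / 2) x : ℝ) : ℂ) := fun k =>
        (hk k).bdd_mul (c := 1) (Continuous.aestronglyMeasurable (by fun_prop))
          (Filter.Eventually.of_forall fun x => by
            rw [mul_comm Complex.I, Complex.norm_exp_ofReal_mul_I])
      simp only [Finset.mul_sum]
      rw [integral_finsetSum _ fun k _ => hbdd k]
      simp only [Complex.ofReal_mul, mul_left_comm _ (linCoeff n m a _ : ℂ)]
      simp only [integral_const_mul, integral_cexp_mul_studentDensity N (hpos _)]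
      have hy := norm_nonneg y
      simp only [studentK_nat_add_half _ hy, studentK_nat_add_half _ (mul_nonneg ha.le hy),
        studentK_nat_add_half _ (mul_nonneg hb.le hy), ← Complex.ofReal_mul,
        ← Complex.ofReal_sum]
      congr 1
      have h := besselPoly_eval_mul_eval ha.le ha1.le n m ‖y‖
      have hexp : Real.exp (-(a * ‖y‖)) * Real.exp (-((1 - a) * ‖y‖)) = Real.exp (-‖y‖) := by
        rw [← Real.exp_add]
        congr 1
        ring
      rw [mul_mul_mul_comm, h, hexp, Finset.mul_sum]
      exact Finset.sum_congr rfl fun k _ => mul_left_comm _ _ _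
  have h := congrFun key x
  simp only [← Complex.ofReal_sum] at h
  exact Complex.ofReal_injective h

theorem mainTheorem8 (N : ℕ) (hN : 1 ≤ N) :
    (∀ ν : ℝ, 0 < ν →
      (∀ x, 0 ≤ studentDensity N ν x) ∧
      Integrable (studentDensity N ν) ∧
      ∫ x, studentDensity N ν x = 1 ∧
      ∀ y : EuclideanSpace ℝ (Fin N),
        ∫ x, Complex.exp (Complex.I * ((inner ℝ x y : ℝ) : ℂ)) * (studentDensity N ν x : ℂ) =
          (studentK ν ‖y‖ : ℂ)) ∧
    (∀ (n m : ℕ) (a : ℝ), 0 < a → a < 1 →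
      (∀ u : ℝ, (besselPoly n).eval (a * u) * (besselPoly m).eval ((1 - a) * u) =
        ∑ k ∈ Finset.Icc (min n m) (n + m), linCoeff n m a k * (besselPoly k).eval u) ∧
      (∀ k, 0 ≤ linCoeff n m a k) ∧
      ∑ k ∈ Finset.Icc (min n m) (n + m), linCoeff n m a k = 1 ∧
      ConvolutionExists
        (fun x => 1 / a ^ N * studentDensity N ((n : ℝ) + 1 / 2) (a⁻¹ • x))
        (fun x => 1 / (1 - a) ^ N * studentDensity N ((m : ℝ) + 1 / 2) ((1 - a)⁻¹ • x))
        (ContinuousLinearMap.mul ℝ ℝ) volume ∧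
      ∀ x : EuclideanSpace ℝ (Fin N),
        ((fun x => 1 / a ^ N * studentDensity N ((n : ℝ) + 1 / 2) (a⁻¹ • x))
          ⋆[ContinuousLinearMap.mul ℝ ℝ, volume]
          (fun x => 1 / (1 - a) ^ N * studentDensity N ((m : ℝ) + 1 / 2) ((1 - a)⁻¹ • x))) x =
          ∑ k ∈ Finset.Icc (min n m) (n + m),
            linCoeff n m a k * studentDensity N ((k : ℝ) + 1 / 2) x) := by
  refine ⟨fun ν hν => ⟨studentDensity_nonneg N hν, integrable_studentDensity N hν,
    integral_studentDensity N hν, integral_cexp_mul_studentDensity N hν⟩,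
    fun n m a h0 h1 => ⟨besselPoly_eval_mul_eval h0.le h1.le n m, linCoeff_nonneg h0.le h1.le n m,
      sum_linCoeff h0.le h1.le n m, ?_, convolution_scaledStudentDensity N n m h0 h1⟩⟩
  exact convolutionExists_scaledStudentDensity N (by positivity) (by positivity) h0
    (sub_pos.mpr h1)
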